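/- Let $a_1,\dots,a_4,b_1,\dots,b_4\in\mathbb{C}$ and let $$A=\begin{pmatrix}0&a_1&0&0\\ a_2&0&0&0\\ 0&0&0&a_3\\ 0&0&a_4&0\end{pmatrix},\qquad B=\operatorname{diag}(b_1,b_2,b_3,b_4).$$ Suppose that $\operatorname{tr}A=\operatorname{tr}B=0$ and $\operatorname{tr}A^\dagger A+\operatorname{tr}B^\dagger B=\tfrac14$ (the condition $\operatorname{tr}A=0$ holds automatically). Let $X=A\otimes I_4+I_4\otimes B$, and let $\sigma_1\ge\sigma_2\ge\dots\ge\sigma_{16}$ be the singular values of $X$, counted with multiplicity. Then $$\sigma_1^2+\sigma_2^2\le\tfrac12 .$$ In other words, the supremum of $\sigma_1^2+\sigma_2^2$ over all such $X$ is at most $\tfrac12$. -/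

import Mathlib

open scoped Kronecker

/-- The `4 × 4` matrix which is block diagonal with the anti-diagonal `2 × 2` blocks
`(0, a₁; a₂, 0)` and `(0, a₃; a₄, 0)`, where `a₁, a₂, a₃, a₄` are `a 0, a 1, a 2, a 3`. -/
def antiBlock (a : Fin 4 → ℂ) : Matrix (Fin 4) (Fin 4) ℂ :=
  !![0, a 0, 0, 0;
     a 1, 0, 0, 0;
     0, 0, 0, a 2;
     0, 0, a 3, 0]

/-- The Kronecker sum `A ⊗ I + I ⊗ B` of two square matrices of the same size. -/
def kroneckerSum {d : ℕ} (A B : Matrix (Fin d) (Fin d) ℂ) :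
    Matrix (Fin d × Fin d) (Fin d × Fin d) ℂ :=
  A ⊗ₖ (1 : Matrix (Fin d) (Fin d) ℂ) + (1 : Matrix (Fin d) (Fin d) ℂ) ⊗ₖ B

/-- The singular values, in descending order and with multiplicity, of a square complex matrix:
`singularValue M 0` is the largest one. They are those of the operator of `M` on the Euclidean
space, and the sequence is continued by zeros beyond the size of `M`. -/
noncomputable def singularValue {n : Type*} [Fintype n] [DecidableEq n]
    (M : Matrix n n ℂ) (i : ℕ) : ℝ :=
  (Matrix.toEuclideanLin M).singularValues i

/-! After a permutation of the basis, `X` is the direct sum of eight blocks `M = (b j, p k; q k, b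
j)`, so `σ₁² + σ₂²` is a sum of eigenvalues `l + m` of `⊕ Mᴴ M` at orthonormal eigenvectors. Write
`P` and `S` for the total squared norms of the `p k, q k` and of the `b j`; then `P + S = 1/4`, and
the goal is `l + m ≤ 2 P + 2 S`. If both vectors live in one block, `l + m` is the trace of `Mᴴ M`.
Otherwise `l` and `m` can be read off in different blocks. For different `j`, the Frobenius bound on
each suffices. For equal `j` it would count `‖b j‖²` four times; `eigenvalue_le_weighted` lowers
this to `8/3`, at the price of doubling the weight of `p` and `q`, and `tr B = 0` gives `4/3 ‖b j‖²
≤ S`. -/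

open ComplexConjugate in
/-- An eigenvector `(x, y)` of `Mᴴ M`, where `M = (b, p; q, b)`, satisfies the Rayleigh identity. -/
theorem rayleigh_two_by_two {b p q x y : ℂ} {l : ℝ}
    (h₁ : conj b * (b * x + p * y) + conj q * (q * x + b * y) = l * x)
    (h₂ : conj p * (b * x + p * y) + conj b * (q * x + b * y) = l * y) :
    l * (‖x‖ ^ 2 + ‖y‖ ^ 2) = ‖b * x + p * y‖ ^ 2 + ‖q * x + b * y‖ ^ 2 := by
  apply Complex.ofReal_injective
  push_cast
  simp only [← Complex.conj_mul', map_add, map_mul]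
  linear_combination (-conj x) * h₁ - conj y * h₂

theorem norm_sq_add_norm_sq_pos {x y : ℂ} (h : x ≠ 0 ∨ y ≠ 0) : 0 < ‖x‖ ^ 2 + ‖y‖ ^ 2 := by
  rcases h with h | h
  · have := norm_pos_iff.2 h
    positivity
  · have := norm_pos_iff.2 h
    positivity

theorem norm_mul_add_mul_sq_le (b p x y : ℂ) :
    ‖b * x + p * y‖ ^ 2 ≤ (‖b‖ * ‖x‖ + ‖p‖ * ‖y‖) ^ 2 := by
  gcongr
  simpa using norm_add_le (b * x) (p * y)

open ComplexConjugate in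
/-- The eigenvalues of `Mᴴ M`, where `M = (b, p; q, b)`, are at most the squared
Frobenius norm of `M`. -/
theorem eigenvalue_le_frobenius {b p q x y : ℂ} {l : ℝ}
    (h₁ : conj b * (b * x + p * y) + conj q * (q * x + b * y) = l * x)
    (h₂ : conj p * (b * x + p * y) + conj b * (q * x + b * y) = l * y)
    (h : x ≠ 0 ∨ y ≠ 0) : l ≤ ‖p‖ ^ 2 + ‖q‖ ^ 2 + 2 * ‖b‖ ^ 2 := by
  refine le_of_mul_le_mul_right ?_ (norm_sq_add_norm_sq_pos h)
  rw [rayleigh_two_by_two h₁ h₂]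
  nlinarith [norm_mul_add_mul_sq_le b p x y, norm_mul_add_mul_sq_le q b x y,
    sq_nonneg (‖b‖ * ‖y‖ - ‖p‖ * ‖x‖), sq_nonneg (‖q‖ * ‖y‖ - ‖b‖ * ‖x‖)]

open ComplexConjugate in
/-- A bound for the eigenvalues of `Mᴴ M`, where `M = (b, p; q, b)`, with a smaller weight
on the diagonal entries than in the Frobenius norm. -/
theorem eigenvalue_le_weighted {b p q x y : ℂ} {l : ℝ}
    (h₁ : conj b * (b * x + p * y) + conj q * (q * x + b * y) = l * x)
    (h₂ : conj p * (b * x + p * y) + conj b * (q * x + b * y) = l * y)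
    (h : x ≠ 0 ∨ y ≠ 0) : l ≤ 2 * ‖p‖ ^ 2 + 2 * ‖q‖ ^ 2 + 4 / 3 * ‖b‖ ^ 2 := by
  refine le_of_mul_le_mul_right ?_ (norm_sq_add_norm_sq_pos h)
  rw [rayleigh_two_by_two h₁ h₂]
  -- The squares enter with weights 2, 1, 1, 2: the cross terms cancel, and the `‖b‖²` terms add up
  -- to exactly the excess `1/3` of `4/3` over 1.
  linarith [norm_mul_add_mul_sq_le b p x y, norm_mul_add_mul_sq_le q b x y,
    sq_nonneg (‖p‖ * ‖x‖ - ‖b‖ * ‖y‖ / 3), sq_nonneg (‖p‖ * ‖y‖ - ‖b‖ * ‖x‖ / 3),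
    sq_nonneg (‖q‖ * ‖x‖ - ‖b‖ * ‖y‖ / 3), sq_nonneg (‖q‖ * ‖y‖ - ‖b‖ * ‖x‖ / 3)]

open ComplexConjugate in
/-- The eigenvalues of `Mᴴ M`, where `M = (b, p; q, b)`, for two orthonormal eigenvectors
add up to the squared Frobenius norm of `M`. -/
theorem eigenvalue_add_eigenvalue_eq {b p q x y z t : ℂ} {l m : ℝ}
    (h₁ : conj b * (b * x + p * y) + conj q * (q * x + b * y) = l * x)
    (h₂ : conj p * (b * x + p * y) + conj b * (q * x + b * y) = l * y)
    (h₃ : conj b * (b * z + p * t) + conj q * (q * z + b * t) = m * z)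
    (h₄ : conj p * (b * z + p * t) + conj b * (q * z + b * t) = m * t)
    (hxy : conj x * x + conj y * y = 1) (hzt : conj z * z + conj t * t = 1)
    (ho : conj x * z + conj y * t = 0) :
    l + m = ‖p‖ ^ 2 + ‖q‖ ^ 2 + 2 * ‖b‖ ^ 2 := by
  -- By the Gram identity the determinant of an orthonormal pair has modulus 1.
  have hd : x * t - y * z ≠ 0 := by
    intro hd
    have : (1 : ℂ) = 0 := by
      linear_combination (conj x * conj t - conj y * conj z) * hd
        - (conj z * z + conj t * t) * hxy - hzt + (x * conj z + y * conj t) * ho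
    exact one_ne_zero this
  apply Complex.ofReal_injective
  push_cast
  simp only [← Complex.conj_mul']
  refine mul_right_cancel₀ hd ?_
  -- For `H = Mᴴ M` this is `det (H v, w) + det (v, H w) = tr H * det (v, w)`.
  linear_combination -t * h₁ + z * h₂ + y * h₃ - x * h₄

/-- Each entry is minus the sum of the other three, so Cauchy–Schwarz bounds its square by three
times the sum of theirs. -/
theorem norm_sq_le_of_sum_eq_zero {b : Fin 4 → ℂ} (hb : ∑ j, b j = 0) (j : Fin 4) :
    4 / 3 * ‖b j‖ ^ 2 ≤ ∑ i, ‖b i‖ ^ 2 := by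
  have key : ∀ u v w r : ℂ, u + v + w + r = 0 →
      ‖u‖ ^ 2 ≤ 3 * (‖v‖ ^ 2 + ‖w‖ ^ 2 + ‖r‖ ^ 2) := by
    intro u v w r h
    have h1 : ‖u‖ ≤ ‖v‖ + ‖w‖ + ‖r‖ := by
      rw [show u = -(v + w + r) by linear_combination h, norm_neg]
      exact norm_add₃_le
    have h2 : ‖u‖ ^ 2 ≤ (‖v‖ + ‖w‖ + ‖r‖) ^ 2 := by gcongr
    linarith [sq_nonneg (‖v‖ - ‖w‖), sq_nonneg (‖w‖ - ‖r‖), sq_nonneg (‖v‖ - ‖r‖)]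
  rw [Fin.sum_univ_four] at hb ⊢
  have h0 := key (b 0) (b 1) (b 2) (b 3) hb
  have h1 := key (b 1) (b 0) (b 2) (b 3) (by linear_combination hb)
  have h2 := key (b 2) (b 0) (b 1) (b 3) (by linear_combination hb)
  have h3 := key (b 3) (b 0) (b 1) (b 2) (by linear_combination hb)
  fin_cases j <;> simp <;> linarith

open ComplexConjugate in
/-- Two eigenvalues, for orthonormal eigenvectors, of the direct sum of the matrices `Mᴴ M`,
where `M` runs through the eight blocks `(b j, p k; q k, b j)`. -/
theorem eigenvalue_add_eigenvalue_le {p q : Fin 2 → ℂ} {b : Fin 4 → ℂ}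
    (hb : ∑ j, b j = 0)
    (hnorm : ∑ k, (‖p k‖ ^ 2 + ‖q k‖ ^ 2) + ∑ j, ‖b j‖ ^ 2 = 1 / 4)
    {x y z t : Fin 2 × Fin 4 → ℂ} {l m : ℝ}
    (h₁ : ∀ s, conj (b s.2) * (b s.2 * x s + p s.1 * y s)
      + conj (q s.1) * (q s.1 * x s + b s.2 * y s) = l * x s)
    (h₂ : ∀ s, conj (p s.1) * (b s.2 * x s + p s.1 * y s)
      + conj (b s.2) * (q s.1 * x s + b s.2 * y s) = l * y s)
    (h₃ : ∀ s, conj (b s.2) * (b s.2 * z s + p s.1 * t s)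
      + conj (q s.1) * (q s.1 * z s + b s.2 * t s) = m * z s)
    (h₄ : ∀ s, conj (p s.1) * (b s.2 * z s + p s.1 * t s)
      + conj (b s.2) * (q s.1 * z s + b s.2 * t s) = m * t s)
    (hxy : ∑ s, (conj (x s) * x s + conj (y s) * y s) = 1)
    (hzt : ∑ s, (conj (z s) * z s + conj (t s) * t s) = 1)
    (ho : ∑ s, (conj (x s) * z s + conj (y s) * t s) = 0) :
    l + m ≤ 1 / 2 := by
  have hp : ∀ k, ‖p k‖ ^ 2 + ‖q k‖ ^ 2 ≤ ∑ k, (‖p k‖ ^ 2 + ‖q k‖ ^ 2) := fun k =>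
    Finset.single_le_sum (f := fun k => ‖p k‖ ^ 2 + ‖q k‖ ^ 2) (fun _ _ => by positivity)
      (Finset.mem_univ k)
  have hp2 : ∀ k k', k ≠ k' → ‖p k‖ ^ 2 + ‖q k‖ ^ 2 + (‖p k'‖ ^ 2 + ‖q k'‖ ^ 2)
      ≤ ∑ k, (‖p k‖ ^ 2 + ‖q k‖ ^ 2) := fun k k' h =>
    Finset.add_le_sum (f := fun k => ‖p k‖ ^ 2 + ‖q k‖ ^ 2) (fun _ _ => by positivity)
      (Finset.mem_univ k) (Finset.mem_univ k') h
  have hb1 : ∀ j, ‖b j‖ ^ 2 ≤ ∑ j, ‖b j‖ ^ 2 := fun j =>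
    Finset.single_le_sum (f := fun j => ‖b j‖ ^ 2) (fun _ _ => by positivity) (Finset.mem_univ j)
  have hb2 : ∀ j j', j ≠ j' → ‖b j‖ ^ 2 + ‖b j'‖ ^ 2 ≤ ∑ j, ‖b j‖ ^ 2 := fun j j' h =>
    Finset.add_le_sum (f := fun j => ‖b j‖ ^ 2) (fun _ _ => by positivity)
      (Finset.mem_univ j) (Finset.mem_univ j') h
  by_cases hs : ∃ s s', s ≠ s' ∧ (x s ≠ 0 ∨ y s ≠ 0) ∧ (z s' ≠ 0 ∨ t s' ≠ 0)
  · obtain ⟨⟨k, j⟩, ⟨k', j'⟩, hne, hv, hw⟩ := hs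
    have f₁ := eigenvalue_le_frobenius (h₁ _) (h₂ _) hv
    have f₂ := eigenvalue_le_frobenius (h₃ _) (h₄ _) hw
    have g₁ := eigenvalue_le_weighted (h₁ _) (h₂ _) hv
    have g₂ := eigenvalue_le_weighted (h₃ _) (h₄ _) hw
    dsimp only at f₁ f₂ g₁ g₂
    by_cases hj : j = j'
    · subst hj
      have hk : k ≠ k' := fun h => hne (by rw [h])
      linarith [hp2 k k' hk, norm_sq_le_of_sum_eq_zero hb j]
    · linarith [hp k, hp k', hb2 j j' hj]
  · push Not at hs
    have exists_ne : ∀ u v : Fin 2 × Fin 4 → ℂ, ∑ s, (conj (u s) * u s + conj (v s) * v s) = 1 →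
        ∃ s, u s ≠ 0 ∨ v s ≠ 0 := by
      intro u v h
      by_contra! hc
      simp [hc] at h
    obtain ⟨s, hxs⟩ := exists_ne x y hxy
    obtain ⟨s', hzs'⟩ := exists_ne z t hzt
    have hss' : s = s' := by
      by_contra hne
      have := hs s s' hne hxs
      tauto
    subst hss'
    have hz : ∀ r, r ≠ s → z r = 0 ∧ t r = 0 := fun r hr => hs s r hr.symm hxs
    have hx : ∀ r, r ≠ s → x r = 0 ∧ y r = 0 := by
      intro r hr
      by_contra hc
      have := hs r s hr (by tauto)
      tauto
    rw [Fintype.sum_eq_single s fun r hr => by simp [hx r hr]] at hxy ho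
    rw [Fintype.sum_eq_single s fun r hr => by simp [hz r hr]] at hzt
    rw [eigenvalue_add_eigenvalue_eq (h₁ s) (h₂ s) (h₃ s) (h₄ s) hxy hzt ho]
    linarith [hp s.1, hb1 s.2, sq_nonneg ‖p s.1‖, sq_nonneg ‖q s.1‖]

open Matrix in
/-- The right singular vectors of a square matrix. -/
theorem exists_singular_vectors {n : Type*} [Fintype n] [DecidableEq n] (M : Matrix n n ℂ)
    {i j : ℕ} (hi : i < Fintype.card n) (hj : j < Fintype.card n) (hij : i ≠ j) :
    ∃ v w : n → ℂ, Mᴴ *ᵥ (M *ᵥ v) = ((singularValue M i ^ 2 : ℝ) : ℂ) • v ∧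
      Mᴴ *ᵥ (M *ᵥ w) = ((singularValue M j ^ 2 : ℝ) : ℂ) • w ∧
      star v ⬝ᵥ v = 1 ∧ star w ⬝ᵥ w = 1 ∧ star v ⬝ᵥ w = 0 := by
  have hn : Module.finrank ℂ (EuclideanSpace ℂ n) = Fintype.card n := finrank_euclideanSpace
  have hT := (toEuclideanLin M).isSymmetric_adjoint_comp_self
  let e := hT.eigenvectorBasis hn
  have heig : ∀ r : Fin (Fintype.card n), Mᴴ *ᵥ (M *ᵥ (e r).ofLp)
      = ((singularValue M r ^ 2 : ℝ) : ℂ) • (e r).ofLp := by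
    intro r
    have h : _ = _ • e r := hT.apply_eigenvectorBasis hn r
    change (_ ∘ₗ _) (e r) = _ at h
    generalize e r = u at h ⊢
    rw [← LinearMap.sq_singularValues_fin _ hn r,
      ← Matrix.toEuclideanLin_conjTranspose_eq_adjoint] at h
    simpa [singularValue] using congrArg WithLp.ofLp h
  have hin : ∀ r s, star (e r).ofLp ⬝ᵥ (e s).ofLp = if r = s then 1 else 0 := by
    intro r s
    rw [← orthonormal_iff_ite.1 e.orthonormal r s, EuclideanSpace.inner_eq_star_dotProduct,
      dotProduct_comm]
  refine ⟨e ⟨i, hi⟩, e ⟨j, hj⟩, heig _, heig _, ?_, ?_, ?_⟩ <;> simp [hin, hij]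

/-- The action of `A ⊗ I + I ⊗ B` splits into `2 × 2` blocks. -/
theorem kroneckerSum_antiBlock_mulVec (a b : Fin 4 → ℂ) (u : Fin 4 × Fin 4 → ℂ)
    (s : Fin 2 × Fin 4) :
    (kroneckerSum (antiBlock a) (Matrix.diagonal b)).mulVec u (![0, 2] s.1, s.2)
        = b s.2 * u (![0, 2] s.1, s.2) + ![a 0, a 2] s.1 * u (![1, 3] s.1, s.2) ∧
      (kroneckerSum (antiBlock a) (Matrix.diagonal b)).mulVec u (![1, 3] s.1, s.2)
        = ![a 1, a 3] s.1 * u (![0, 2] s.1, s.2) + b s.2 * u (![1, 3] s.1, s.2) := by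
  obtain ⟨k, j⟩ := s
  fin_cases k <;> fin_cases j <;>
  simp [kroneckerSum, antiBlock, Matrix.mulVec, dotProduct, Fintype.sum_prod_type,
    Fin.sum_univ_four, Matrix.one_apply, Matrix.diagonal_apply, add_comm]

open ComplexConjugate in
-- The adjoint has the same shape, so `kroneckerSum_antiBlock_mulVec` describes the action of `Xᴴ`
-- as well as that of `X`.
theorem conjTranspose_kroneckerSum_antiBlock (a b : Fin 4 → ℂ) :
    (kroneckerSum (antiBlock a) (Matrix.diagonal b)).conjTranspose
      = kroneckerSum (antiBlock ![conj (a 1), conj (a 0), conj (a 3), conj (a 2)])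
          (Matrix.diagonal fun j => conj (b j)) := by
  have hA : (antiBlock a).conjTranspose
      = antiBlock ![conj (a 1), conj (a 0), conj (a 3), conj (a 2)] := by
    ext i j
    fin_cases i <;> fin_cases j <;> simp [antiBlock]
  rw [kroneckerSum, Matrix.conjTranspose_add, Matrix.conjTranspose_kronecker,
    Matrix.conjTranspose_kronecker, hA, Matrix.conjTranspose_one, Matrix.diagonal_conjTranspose]
  rfl

open ComplexConjugate in
/-- The eigenvector equation of `Xᴴ X`, for `X = A ⊗ I + I ⊗ B`, on each `2 × 2` block. -/
theorem block_eigenvector {a b : Fin 4 → ℂ} {u : Fin 4 × Fin 4 → ℂ} {l : ℂ}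
    (h : (kroneckerSum (antiBlock a) (Matrix.diagonal b)).conjTranspose.mulVec
      ((kroneckerSum (antiBlock a) (Matrix.diagonal b)).mulVec u) = l • u)
    {p q : Fin 2 → ℂ} (hp : p = ![a 0, a 2]) (hq : q = ![a 1, a 3])
    {x y : Fin 2 × Fin 4 → ℂ} (hx : x = fun s => u (![0, 2] s.1, s.2))
    (hy : y = fun s => u (![1, 3] s.1, s.2)) (s : Fin 2 × Fin 4) :
    conj (b s.2) * (b s.2 * x s + p s.1 * y s)
        + conj (q s.1) * (q s.1 * x s + b s.2 * y s) = l * x s ∧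
      conj (p s.1) * (b s.2 * x s + p s.1 * y s)
        + conj (b s.2) * (q s.1 * x s + b s.2 * y s) = l * y s := by
  have h₁ := congrFun h (![0, 2] s.1, s.2)
  have h₂ := congrFun h (![1, 3] s.1, s.2)
  rw [conjTranspose_kroneckerSum_antiBlock] at h₁ h₂
  rw [(kroneckerSum_antiBlock_mulVec _ _ _ s).1] at h₁
  rw [(kroneckerSum_antiBlock_mulVec _ _ _ s).2] at h₂
  rw [(kroneckerSum_antiBlock_mulVec _ _ _ s).1, (kroneckerSum_antiBlock_mulVec _ _ _ s).2]
    at h₁ h₂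
  subst hp hq hx hy
  obtain ⟨k, j⟩ := s
  fin_cases k <;> exact ⟨by simpa using h₁, by simpa using h₂⟩

open ComplexConjugate in
theorem dotProduct_eq_sum_blocks (u v : Fin 4 × Fin 4 → ℂ) :
    star u ⬝ᵥ v = ∑ s : Fin 2 × Fin 4,
      (conj (u (![0, 2] s.1, s.2)) * v (![0, 2] s.1, s.2)
        + conj (u (![1, 3] s.1, s.2)) * v (![1, 3] s.1, s.2)) := by
  simp only [dotProduct, Fintype.sum_prod_type, Fin.sum_univ_four, Fin.sum_univ_two]
  simp
  ring

theorem mainTheorem2 (a b : Fin 4 → ℂ) (A B : Matrix (Fin 4) (Fin 4) ℂ)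
    (hA : A = antiBlock a) (hB : B = Matrix.diagonal b)
    (htrA : A.trace = 0) (htrB : B.trace = 0)
    (hnorm : (A.conjTranspose * A).trace + (B.conjTranspose * B).trace = 1 / 4) :
    singularValue (kroneckerSum A B) 0 ^ 2 + singularValue (kroneckerSum A B) 1 ^ 2 ≤ 1 / 2 := by
  subst hA hB
  obtain ⟨v, w, hv, hw, hvv, hww, hvw⟩ :=
    exists_singular_vectors (kroneckerSum (antiBlock a) (Matrix.diagonal b)) (i := 0) (j := 1)
      (by simp) (by simp) zero_ne_one
  rw [dotProduct_eq_sum_blocks] at hvv hww hvw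
  have ev := block_eigenvector hv rfl rfl rfl rfl
  have ew := block_eigenvector hw rfl rfl rfl rfl
  refine eigenvalue_add_eigenvalue_le (by simpa using htrB) ?_ (fun s => (ev s).1)
    (fun s => (ev s).2) (fun s => (ew s).1) (fun s => (ew s).2) hvv hww hvw
  apply Complex.ofReal_injective
  push_cast
  rw [← hnorm]
  simp [antiBlock, Matrix.trace, Matrix.mul_apply, Fin.sum_univ_four, ← Complex.conj_mul']
  ring
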